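/- Let $\sigma$ be a finite relational signature, each symbol $R\in\sigma$ having an arity $k_R\in\mathbb N$. Order the labels $\varnothing,0,1,\star$ by $\varnothing\preceq 0\preceq\star$ and $\varnothing\preceq 1\preceq\star$, with $0,1$ incomparable. A $\varnothing$-structure $\mathbf G$ consists of a finite set $G$ and, for each $R\in\sigma$, a map $R^{\mathbf G}\colon G^{k_R}\to\{\varnothing,0,1,\star\}$. A homomorphism $\mathbf G\to\mathbf H$ is a map $h\colon G\to H$ with $R^{\mathbf G}(\mathbf t)\preceq R^{\mathbf H}(h(\mathbf t))$ for all $R\in\sigma$ and $\mathbf t\in G^{k_R}$; $\mathbf G$ is a core if every homomorphism $\mathbf G\to\mathbf G$ is an isomorphism. For a $\varnothing$-structure $\mathbf H$, let $\mathrm{MP}_\varnothing(\mathbf H)$ be the set of $\varnothing$-structures that admit a homomorphism to $\mathbf H$. A $\varnothing$-structure $\mathbf G$ is a hom-minimal obstruction for $\mathrm{MP}_\varnothing(\mathbf H)$ if (1) $\mathbf G$ is a core and $\mathbf G\not\to\mathbf H$, and (2) every $\varnothing$-structure $\mathbf G'$ with $\mathbf G'\to\mathbf G$ and $\mathbf G\not\to\mathbf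 G'$ satisfies $\mathbf G'\to\mathbf H$. Let $\mathbf G_{\mathrm{CSP}}$ be the relational structure with domain $G$ that has, for each $R\in\sigma$ and $j\in\{0,1\}$, a relation $R_j$ of arity $k_R$, where $\mathbf t\in R_j$ if and only if $j\preceq R^{\mathbf G}(\mathbf t)$. By a tuple of a relational structure we mean a pair consisting of a relation symbol and a tuple that belongs to this relation. A cycle of length $n\ge 2$ consists of $n$ distinct elements $x_1,\dots,x_n$ and $n$ distinct tuples $\mathbf t_1,\dots,\mathbf t_n$ such that $x_i$ is an entry of both $\mathbf t_i$ and $\mathbf t_{i+1}$ for $1\le i\le n-1$, and $x_n$ is an entry of both $\mathbf t_n$ and $\mathbf t_1$. A cycle of length $1$ is a tuple in which some element occurs at least twice. Then for every $\varnothing$-structure $\mathbf H$ and every hom-minimal obstruction $\mathbf G$ for $\mathrm{MP}_\varnothing(\mathbf H)$, the relational structure $\mathbf G_{\mathrm{CSP}}$ contains no cycle. -/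

import Mathlib

universe u v w

namespace MatrixPartition

/-- A finite relational signature: finitely many relation symbols, each with an arity. -/
structure Signature where
  Symb : Type v
  finite_symb : Finite Symb
  arity : Symb → ℕ

/-- A `(P, σ)`-structure: a finite domain in which, for every symbol `R` of arity `k`,
every `k`-tuple is labelled by an element of `P`. -/
structure LabelledStructure (P : Type w) (σ : Signature.{v}) where
  Carrier : Type u
  finite_carrier : Finite Carrier
  rel : (R : σ.Symb) → (Fin (σ.arity R) → Carrier) → P

namespace LabelledStructure

variable {P : Type w} [PartialOrder P] {σ : Signature.{v}}

/-- `h` is a homomorphism `A → B`: labels may only go up. -/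
def IsHom (A B : LabelledStructure.{u} P σ) (h : A.Carrier → B.Carrier) : Prop :=
  ∀ (R : σ.Symb) (t : Fin (σ.arity R) → A.Carrier), A.rel R t ≤ B.rel R (h ∘ t)

/-- `A → B`: there is a homomorphism from `A` to `B`. -/
def MapsTo (A B : LabelledStructure.{u} P σ) : Prop :=
  ∃ h : A.Carrier → B.Carrier, IsHom A B h

/-- `h` is an isomorphism `A → B`: a label-preserving bijection. -/
def IsIso (A B : LabelledStructure.{u} P σ) (h : A.Carrier → B.Carrier) : Prop :=
  Function.Bijective h ∧
    ∀ (R : σ.Symb) (t : Fin (σ.arity R) → A.Carrier), A.rel R t = B.rel R (h ∘ t)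

/-- `A` is a core: every endomorphism of `A` is an isomorphism. -/
def IsCore (A : LabelledStructure.{u} P σ) : Prop :=
  ∀ h : A.Carrier → A.Carrier, IsHom A A h → IsIso A A h

end LabelledStructure

/-- The labels `∅, 0, 1, ⋆`. -/
inductive EmptyLabel where
  | empty
  | zero
  | one
  | star
  deriving DecidableEq

/-- The order `∅ ≤ 0 ≤ ⋆`, `∅ ≤ 1 ≤ ⋆`, with `0` and `1` incomparable. -/
instance : PartialOrder EmptyLabel where
  le a b := a = b ∨ a = EmptyLabel.empty ∨ b = EmptyLabel.star
  le_refl a := Or.inl rfl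
  le_trans a b c := by cases a <;> cases b <;> cases c <;> simp
  le_antisymm a b := by cases a <;> cases b <;> simp

/-- The element `j ∈ {0, 1}` seen as a label. -/
def EmptyLabel.ofFin (j : Fin 2) : EmptyLabel :=
  if j = 0 then EmptyLabel.zero else EmptyLabel.one

/-- `∅`-structures over `σ`. -/
abbrev EmptyStructure (σ : Signature.{v}) := LabelledStructure.{u} EmptyLabel σ

/-- Relational structures over `σ`: the labels are `0 ≤ 1`, and a tuple belongs to the relation
when its label is `1`. -/
abbrev RelationalStructure (σ : Signature.{v}) := LabelledStructure.{u} (Fin 2) σ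

/-- The set of hom-minimal obstructions, among `∅`-structures, for the problem of mapping
homomorphically to `H`. -/
def homMinimalObstructions {σ : Signature.{v}} (H : EmptyStructure.{u} σ) :
    Set (EmptyStructure.{u} σ) :=
  {G | G.IsCore ∧ ¬ G.MapsTo H ∧
    ∀ G' : EmptyStructure.{u} σ, G'.MapsTo G → ¬ G.MapsTo G' → G'.MapsTo H}

/-- The signature with two symbols `(R, 0)`, `(R, 1)`, of the arity of `R`, for each `R` in `σ`. -/
def Signature.csp (σ : Signature.{v}) : Signature.{v} where
  Symb := σ.Symb × Fin 2
  finite_symb := by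
    have := σ.finite_symb
    infer_instance
  arity := fun Rj => σ.arity Rj.1

open Classical in
/-- The relational structure of an `∅`-structure `A`: the same domain, where `t` belongs to
`(R, j)` exactly when `j ≤ R(t)`. -/
noncomputable def EmptyStructure.toCSP {σ : Signature.{v}} (A : EmptyStructure.{u} σ) :
    RelationalStructure.{u} σ.csp where
  Carrier := A.Carrier
  finite_carrier := A.finite_carrier
  rel := fun Rj t => if EmptyLabel.ofFin Rj.2 ≤ A.rel Rj.1 t then 1 else 0

namespace RelationalStructure

variable {σ : Signature.{v}}

/-- For `n ≥ 2`: distinct elements `x₁, …, xₙ` and distinct tuples `t₁, …, tₙ` of the relations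
(a tuple being taken together with its relation symbol) such that `xᵢ` is an entry of both
`tᵢ` and `tᵢ₊₁`, the indices being read cyclically. -/
def HasLongCycle (A : RelationalStructure.{u} σ) (n : ℕ) : Prop :=
  ∃ (x : Fin n → A.Carrier) (t : Fin n → (R : σ.Symb) × (Fin (σ.arity R) → A.Carrier)),
    Function.Injective x ∧ Function.Injective t ∧
    (∀ i, A.rel (t i).1 (t i).2 = 1) ∧
    (∀ i, x i ∈ Set.range (t i).2) ∧
    (∀ i, x i ∈ Set.range (t (finRotate n i)).2)

/-- A cycle of length one: a tuple of some relation in which an entry is repeated. -/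
def HasLoop (A : RelationalStructure.{u} σ) : Prop :=
  ∃ (R : σ.Symb) (t : Fin (σ.arity R) → A.Carrier),
    A.rel R t = 1 ∧ ¬ Function.Injective t

/-- `A` contains a cycle. -/
def HasCycle (A : RelationalStructure.{u} σ) : Prop :=
  A.HasLoop ∨ ∃ n : ℕ, 2 ≤ n ∧ A.HasLongCycle n

end RelationalStructure

end MatrixPartition

namespace MatrixPartition

namespace EmptyLabel

/-! The four labels are the subsets of {0, 1}, so a single tuple `T₀` of `G_CSP` can be altered
independently of the rest. Take `N` copies of `G`, but let `T₀` survive only in split form, with one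
chosen entry in an earlier copy than all the others. This structure projects to `G`. For large `N`
it does not map to `H`, since two copies would have the same image and reglue `T₀`
(`exists_not_splitCopies_mapsTo`). By minimality `G` maps to it, and since `G` is a core the map can
be taken to be a section `x ↦ (x, c x)`. The colouring `c` separates the chosen entry of `T₀` from
the others and is constant on every other tuple (`exists_separating_colouring`). A cycle through
`T₀` would force two of the separated entries to share a colour. -/

theorem le_def (a b : EmptyLabel) : a ≤ b ↔ a = b ∨ a = empty ∨ b = star := Iff.rfl

/-- The labels form the Boolean lattice on {0, 1}, with order as inclusion. Hence homomorphisms can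
be checked on each pair `(R, j)` separately. -/
theorem le_iff_forall_ofFin_le (a b : EmptyLabel) :
    a ≤ b ↔ ∀ j, ofFin j ≤ a → ofFin j ≤ b := by
  rw [Fin.forall_fin_two]
  cases a <;> cases b <;> simp [le_def, ofFin]

/-- Labels correspond to subsets of `{0, 1}`. -/
theorem exists_ofFin_le_iff (S : Fin 2 → Prop) : ∃ a : EmptyLabel, ∀ j, ofFin j ≤ a ↔ S j := by
  simp only [Fin.forall_fin_two]
  by_cases h0 : S 0 <;> by_cases h1 : S 1
  · exact ⟨star, by simp [le_def, h0, h1]⟩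
  · exact ⟨zero, by simp [le_def, ofFin, h0, h1]⟩
  · exact ⟨one, by simp [le_def, ofFin, h0, h1]⟩
  · exact ⟨empty, by simp [le_def, ofFin, h0, h1]⟩

/-- The label lying above exactly the elements of `S`. -/
noncomputable def ofSet (S : Fin 2 → Prop) : EmptyLabel := (exists_ofFin_le_iff S).choose

@[simp] theorem ofFin_le_ofSet (S : Fin 2 → Prop) (j : Fin 2) : ofFin j ≤ ofSet S ↔ S j :=
  (exists_ofFin_le_iff S).choose_spec j

end EmptyLabel

open EmptyLabel LabelledStructure

/-- The type of pairs of a relation symbol and a tuple of elements of `A`. -/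
abbrev TupleOf (σ : Signature.{v}) (A : Type u) := (R : σ.Symb) × (Fin (σ.arity R) → A)

variable {σ : Signature.{v}}

theorem isHom_iff_ofFin {A B : EmptyStructure.{u} σ} {h : A.Carrier → B.Carrier} :
    IsHom A B h ↔ ∀ R t j, ofFin j ≤ A.rel R t → ofFin j ≤ B.rel R (h ∘ t) :=
  forall₂_congr fun _ _ => le_iff_forall_ofFin_le _ _

theorem LabelledStructure.IsIso.exists_inverse {A : EmptyStructure.{u} σ}
    {h : A.Carrier → A.Carrier} (hh : IsIso A A h) : ∃ e, IsHom A A e ∧ ∀ x, h (e x) = x := by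
  obtain ⟨e, -, he⟩ := Function.bijective_iff_has_inverse.1 hh.1
  refine ⟨e, fun R t => ?_, he⟩
  rw [hh.2 R (e ∘ t), ← Function.comp_assoc, funext he (f := h ∘ e) (g := id), Function.id_comp]

/-- The condition under which a tuple `s` over `N` copies of `A` is kept when the tuple `T₀` is
split at position `p`: the copies of `T₀` have their entry at `p` in an earlier copy than all the
other entries, which share a copy; any other tuple stays within one copy. -/
def SplitCondition {A : Type u} (T₀ : TupleOf σ.csp A) (p : ℕ) {N : ℕ}
    (R : σ.Symb) (j : Fin 2) (s : Fin (σ.arity R) → A × Fin N) : Prop :=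
  ((⟨(R, j), Prod.fst ∘ s⟩ : TupleOf σ.csp A) ≠ T₀ → ∃ b, ∀ r, (s r).2 = b) ∧
  ((⟨(R, j), Prod.fst ∘ s⟩ : TupleOf σ.csp A) = T₀ →
    ∃ a b, a < b ∧ ∀ r, (s r).2 = if (r : ℕ) = p then a else b)

/-- `N` copies of `A`, where the tuple `T₀` is split at position `p`. -/
noncomputable def splitCopies (A : EmptyStructure.{u} σ) (T₀ : TupleOf σ.csp A.Carrier) (p N : ℕ) :
    EmptyStructure.{u} σ where
  Carrier := A.Carrier × Fin N
  finite_carrier := by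
    have := A.finite_carrier
    infer_instance
  rel R s := ofSet fun j => ofFin j ≤ A.rel R (Prod.fst ∘ s) ∧ SplitCondition T₀ p R j s

section splitCopies

variable {A H : EmptyStructure.{u} σ} {T₀ : TupleOf σ.csp A.Carrier} {p N : ℕ}

theorem ofFin_le_splitCopies_rel {R : σ.Symb} {s : Fin (σ.arity R) → A.Carrier × Fin N}
    {j : Fin 2} : ofFin j ≤ (splitCopies A T₀ p N).rel R s ↔
      ofFin j ≤ A.rel R (Prod.fst ∘ s) ∧ SplitCondition T₀ p R j s :=
  ofFin_le_ofSet _ _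

theorem isHom_fst_splitCopies : IsHom (splitCopies A T₀ p N) A Prod.fst :=
  isHom_iff_ofFin.2 fun _ _ _ h => (ofFin_le_splitCopies_rel.1 h).1

theorem exists_not_splitCopies_mapsTo (T₀ : TupleOf σ.csp A.Carrier) (p : ℕ)
    (hAH : ¬ A.MapsTo H) : ∃ N, ¬ (splitCopies A T₀ p N).MapsTo H := by
  have := A.finite_carrier
  have := H.finite_carrier
  have := Fintype.ofFinite (A.Carrier → H.Carrier)
  -- One copy more than there are maps `A → H`: by pigeonhole `f` restricts to the same map on two
  -- copies.
  refine ⟨Fintype.card (A.Carrier → H.Carrier) + 1, fun ⟨f, hf⟩ => hAH ?_⟩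
  rw [isHom_iff_ofFin] at hf
  obtain ⟨a, b, hab, hfab⟩ : ∃ a b, a < b ∧ ∀ x, f (x, a) = f (x, b) := by
    obtain ⟨a, b, hne, heq⟩ := Fintype.exists_ne_map_eq_of_card_lt
      (fun (i : Fin (Fintype.card (A.Carrier → H.Carrier) + 1)) x => f (x, i)) (by simp)
    rcases hne.lt_or_gt with h | h
    · exact ⟨a, b, h, congrFun heq⟩
    · exact ⟨b, a, h, congrFun heq.symm⟩
  refine ⟨fun x => f (x, b), isHom_iff_ofFin.2 fun R t j hj => ?_⟩
  -- For `T₀`, the split tuple across copies `a` and `b` has the same image under `f` as the unsplit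
  -- tuple in copy `b`.
  by_cases hT : (⟨(R, j), t⟩ : TupleOf σ.csp A.Carrier) = T₀
  · convert hf R (fun r => (t r, if (r : ℕ) = p then a else b)) j
      (ofFin_le_splitCopies_rel.2 ⟨hj, fun h => absurd hT h, fun _ => ⟨a, b, hab, fun _ => rfl⟩⟩)
      using 2
    funext r
    change f (t r, b) = f (t r, if (r : ℕ) = p then a else b)
    split_ifs
    · exact (hfab _).symm
    · rfl
  · exact hf R (fun r => (t r, b)) j
      (ofFin_le_splitCopies_rel.2 ⟨hj, fun _ => ⟨b, fun _ => rfl⟩, fun h => absurd h hT⟩)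

/-- For a core `A`, a homomorphism to the split copies yields one that is a section of the
projection. -/
theorem LabelledStructure.IsCore.exists_section (hA : A.IsCore)
    (h : A.MapsTo (splitCopies A T₀ p N)) :
    ∃ c : A.Carrier → Fin N, IsHom A (splitCopies A T₀ p N) fun x => (x, c x) := by
  obtain ⟨h, hh⟩ := h
  -- Projecting `h` gives an endomorphism of the core `A`; precomposing `h` with its inverse makes
  -- the first coordinate the identity.
  obtain ⟨e, he, hhe⟩ := (hA (Prod.fst ∘ h)
    fun R t => (hh R t).trans (isHom_fst_splitCopies R _)).exists_inverse
  refine ⟨fun x => (h (e x)).2, fun R t => (he R t).trans ?_⟩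
  convert hh R (e ∘ t) using 2
  funext r
  exact Prod.ext (hhe (t r)).symm rfl

end splitCopies

theorem toCSP_rel_eq_one {A : EmptyStructure.{u} σ} {R : σ.Symb} {j : Fin 2}
    {t : Fin (σ.arity R) → A.Carrier} : A.toCSP.rel (R, j) t = 1 ↔ ofFin j ≤ A.rel R t := by
  simp [EmptyStructure.toCSP]

/-- In a hom-minimal obstruction, two positions of a tuple are separated by a colouring that is
constant on every other tuple. -/
theorem exists_separating_colouring {H G : EmptyStructure.{u} σ}
    (hG : G ∈ homMinimalObstructions H) (T₀ : TupleOf σ.csp G.Carrier)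
    (hT₀ : G.toCSP.rel T₀.1 T₀.2 = 1) {p q : Fin (σ.csp.arity T₀.1)} (hpq : p ≠ q) :
    ∃ (N : ℕ) (c : G.Carrier → Fin N), c (T₀.2 p) ≠ c (T₀.2 q) ∧
      ∀ T : TupleOf σ.csp G.Carrier, G.toCSP.rel T.1 T.2 = 1 → T ≠ T₀ →
        ∀ r r', c (T.2 r) = c (T.2 r') := by
  obtain ⟨hcore, hGH, hmin⟩ := hG
  obtain ⟨N, hN⟩ := exists_not_splitCopies_mapsTo T₀ p hGH
  -- The split copies map to `G` but not to `H`, so minimality forces a homomorphism from `G` back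
  -- to them.
  obtain ⟨c, hc⟩ := hcore.exists_section
    (not_not.1 (mt (hmin (splitCopies G T₀ p N) ⟨_, isHom_fst_splitCopies⟩) hN))
  have key (T : TupleOf σ.csp G.Carrier) (hT : G.toCSP.rel T.1 T.2 = 1) :=
    (ofFin_le_splitCopies_rel.1 (isHom_iff_ofFin.1 hc _ _ _ (toCSP_rel_eq_one.1 hT))).2
  refine ⟨N, c, ?_, fun T hT hne r r' => ?_⟩
  · obtain ⟨a, b, hab, h⟩ := (key T₀ hT₀).2 rfl
    have hp : c (T₀.2 p) = a := (h p).trans (if_pos rfl)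
    have hq : c (T₀.2 q) = b := (h q).trans (if_neg fun h => hpq (Fin.ext h.symm))
    rw [hp, hq]
    exact hab.ne
  · obtain ⟨b, h⟩ := (key T hT).1 hne
    exact (h r).trans (h r').symm

end MatrixPartition

open MatrixPartition in
-- Splitting the tuple at one of two positions with the same entry would give that element two
-- colours.
theorem not_hasLoop_toCSP {σ : Signature.{v}} {H G : EmptyStructure.{u} σ}
    (hG : G ∈ homMinimalObstructions H) : ¬ RelationalStructure.HasLoop G.toCSP := by
  rintro ⟨R, t, ht, hinj⟩
  obtain ⟨p, q, heq, hpq⟩ := Function.not_injective_iff.1 hinj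
  obtain ⟨N, c, hne, -⟩ := exists_separating_colouring hG ⟨R, t⟩ ht hpq
  exact hne (congrArg c heq)

open MatrixPartition in
theorem not_hasLongCycle_toCSP {σ : Signature.{v}} {H G : EmptyStructure.{u} σ}
    (hG : G ∈ homMinimalObstructions H) {n : ℕ} (hn : 2 ≤ n) :
    ¬ RelationalStructure.HasLongCycle G.toCSP n := by
  rintro ⟨x, t, hx, ht, hrel, hmem, hmem'⟩
  obtain ⟨m, rfl⟩ := Nat.exists_eq_add_of_le' hn
  obtain ⟨p, hp⟩ := hmem 0
  -- The tuple to split is `t 0`, which closes the cycle by joining the last element to `x 0`; the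
  -- remaining tuples form a path between these two elements.
  obtain ⟨q, hq⟩ : x (Fin.last (m + 1)) ∈ Set.range (t 0).2 := by
    have := hmem' (Fin.last (m + 1))
    rwa [finRotate_last] at this
  have hpq : p ≠ q := by
    rintro rfl
    exact Fin.last_pos.ne (hx (hp.symm.trans hq))
  obtain ⟨N, c, hne, hc⟩ := exists_separating_colouring hG (t 0) (hrel 0) hpq
  have hconst (i : Fin (m + 2)) : c (x i) = c (x 0) := by
    induction i using Fin.induction with
    | zero => rfl
    | succ i ih =>
      obtain ⟨r, hr⟩ := hmem i.succ
      obtain ⟨r', hr'⟩ : x i.castSucc ∈ Set.range (t i.succ).2 := by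
        have := hmem' i.castSucc
        rwa [finRotate_apply, Fin.coeSucc_eq_succ] at this
      rw [← ih, ← hr, ← hr']
      -- Consecutive elements share the tuple `t i.succ`, which is not the split one, so the colour
      -- propagates along the path.
      exact hc _ (hrel _) (fun h => i.succ_ne_zero (ht h)) r r'
  apply hne
  rw [hp, hq]
  exact (hconst _).symm

theorem mainTheorem8 (σ : MatrixPartition.Signature.{v})
    (H G : MatrixPartition.EmptyStructure.{u} σ)
    (hG : G ∈ MatrixPartition.homMinimalObstructions H) :
    ¬ MatrixPartition.RelationalStructure.HasCycle
        (MatrixPartition.EmptyStructure.toCSP G) := by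
  rintro (h | ⟨n, hn, h⟩)
  · exact not_hasLoop_toCSP hG h
  · exact not_hasLongCycle_toCSP hG hn h
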